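/- **Theorem 2 (anti-Morse lemma).** A metric space $X$ is called $\delta$-hyperbolic if $(x,z)_p\ge\min\{(x,y)_p,(y,z)_p\}-\delta$ for all $p,x,y,z\in X$, where $(x,y)_p=\frac12\bigl(d(x,p)+d(y,p)-d(x,y)\bigr)$. A $(\lambda,c)$-quasi-geodesic is a (not necessarily continuous) map $\gamma:[0,l]\to X$, $l\ge 0$, such that $\frac1\lambda|s-t|-c\le d(\gamma(s),\gamma(t))\le\lambda|s-t|+c$ for all $s,t\in[0,l]$. A geodesic segment is an isometric embedding $\sigma:[0,L]\to X$, $L\ge0$. For every $\lambda_0>1$ there is a constant $A_3>0$, depending only on $\lambda_0$, such that the following holds. Let $X$ be a $\delta$-hyperbolic metric space, let $\lambda\ge\lambda_0$ satisfy $4\delta\le\ln\lambda$ (in particular, whenever $4\delta\ll\ln\lambda$), and let $\gamma:[0,l]\to X$ be a $(\lambda,c)$-quasi-geodesic. If $\sigma$ is a geodesic segment from $\gamma(0)$ to $\gamma(l)$, then $\sigma$ lies in the $A_3(c+\delta)\ln\lambda$-neighbourhood of $\gamma$, that is, every point of $\sigma$ is at distance at most $A_3(c+\delta)\ln\lambda$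 from some point of $\gamma$. Consequently, $\gamma$ is $O(\ln\lambda)$-quasiconvex: every geodesic segment joining two points of $\gamma$ lies in the $A_3(c+\delta)\ln\lambda$-neighbourhood of $\gamma$. -/

import Mathlib

namespace AntiMorse

/-- Gromov's product `(x, y)_p` of two points `x`, `y` at the point `p`. -/
noncomputable def gromovProduct {X : Type*} [MetricSpace X] (x y p : X) : ℝ :=
  (dist x p + dist y p - dist x y) / 2

/-- A metric space is `δ`-hyperbolic if the four-point inequality
`(x, z)_p ≥ min {(x, y)_p, (y, z)_p} - δ` holds for all `p, x, y, z`. -/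
def IsHyperbolic (X : Type*) [MetricSpace X] (δ : ℝ) : Prop :=
  ∀ p x y z : X,
    min (gromovProduct x y p) (gromovProduct y z p) - δ ≤ gromovProduct x z p

/-- `γ` restricted to the real interval `[0, l]` is a `(lam, c)`-quasi-geodesic: a map of the
interval into `X` with `|s - t| / lam - c ≤ d(γ s, γ t) ≤ lam |s - t| + c`.
Continuity is not required. -/
def IsQuasiGeodesic {X : Type*} [MetricSpace X] (lam c l : ℝ) (γ : ℝ → X) : Prop :=
  0 ≤ l ∧ ∀ s ∈ Set.Icc 0 l, ∀ t ∈ Set.Icc 0 l,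
    (1 / lam) * |s - t| - c ≤ dist (γ s) (γ t) ∧ dist (γ s) (γ t) ≤ lam * |s - t| + c

/-- `σ` restricted to `[0, L]` is a geodesic segment (an isometric embedding of `[0, L]`)
from `x` to `y`. -/
def IsGeodesicSegment {X : Type*} [MetricSpace X] (L : ℝ) (σ : ℝ → X) (x y : X) : Prop :=
  0 ≤ L ∧ (∀ s ∈ Set.Icc 0 L, ∀ t ∈ Set.Icc 0 L, dist (σ s) (σ t) = |s - t|) ∧
    σ 0 = x ∧ σ L = y

/-- `A` lies in the `R`-neighbourhood of `S`: every point of `A` is at distance at most `R` from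
some point of `S`. -/
def InNeighborhood {X : Type*} [MetricSpace X] (R : ℝ) (A S : Set X) : Prop :=
  ∀ a ∈ A, ∃ s ∈ S, dist a s ≤ R

/-- `S` is `R`-quasiconvex: every geodesic segment joining two points of `S` lies in the
`R`-neighbourhood of `S`. -/
def IsQuasiconvex {X : Type*} [MetricSpace X] (R : ℝ) (S : Set X) : Prop :=
  ∀ x ∈ S, ∀ y ∈ S, ∀ (L : ℝ) (σ : ℝ → X), IsGeodesicSegment L σ x y →
    InNeighborhood R (σ '' Set.Icc 0 L) S

end AntiMorse

/-!
Let `p = σ τ` be a point of the geodesic at maximal distance `D` from the image of `γ`. Going a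
distance `2D` along `σ` on either side of `p` (or stopping at an endpoint, which lies on `γ`) gives
points `y`, `z` with `(y, z)_p = 0`. They are about `D`-close to points `γ a`, `γ b`, and since
`d(γ a, γ b)` is at most about `6D`, the lower quasi-geodesic inequality bounds `|a - b|` by about
`6 λ D`. Cut the interval from `a` to `b` into `2 ^ k` equal pieces. All the points of this
subdivision are at distance at least `D` from `p`, so consecutive ones have Gromov product at `p` at
least `D` minus half of their distance; by dyadic iteration of the four-point inequality
(`IsHyperbolic.gromovProduct_chain`) the Gromov product `(y, z)_p = 0` is at least `D` minus half of
the step minus `(k + 2) δ`. Steps of size comparable to `m ≥ max c δ` are reached as soon as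
`2 ^ k ≥ λ² (6 D / m + 3)`, which means that `D / m ≲ log λ + log (D / m)` and so `D / m ≲ log λ`
(`infDist_le_of_isMaximal`).

The parameter `m` is any positive number that dominates `c` and `δ`. For `c + δ > 0` it is taken to
be `c + δ`. For `c = δ = 0` letting it tend to zero gives `D = 0`, and the image of `γ`, which is
then Lipschitz on `[0, l]`, is compact, so that the points of `σ` belong to it.

The argument never uses that the endpoints of `σ` are `γ 0` and `γ l`, only that they are on `γ`,
so it proves quasiconvexity directly.
-/

namespace AntiMorse

variable {X : Type*} [MetricSpace X]

/-! ### Gromov products along chains -/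

lemma IsHyperbolic.nonneg [Nonempty X] {δ : ℝ} (h : IsHyperbolic X δ) : 0 ≤ δ := by
  obtain ⟨x⟩ := ‹Nonempty X›
  have := h x x x x
  simp only [gromovProduct, dist_self, min_self] at this
  linarith

/-- Four-point inequality with a common lower bound for the two products. -/
lemma IsHyperbolic.le_gromovProduct {δ : ℝ} (h : IsHyperbolic X δ) {p x y z : X} {r : ℝ}
    (h₁ : r ≤ gromovProduct x y p) (h₂ : r ≤ gromovProduct y z p) :
    r - δ ≤ gromovProduct x z p :=
  le_trans (sub_le_sub_right (le_min h₁ h₂) δ) (h p x y z)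

/-- In a chain of `2 ^ k` steps the four-point inequality is iterated by halving the chain, so that
only `k δ` is lost. -/
lemma IsHyperbolic.gromovProduct_chain {δ : ℝ} (h : IsHyperbolic X δ) {p : X} {r : ℝ} (k : ℕ)
    (f : ℕ → X) (hf : ∀ i < 2 ^ k, r ≤ gromovProduct (f i) (f (i + 1)) p) :
    r - k * δ ≤ gromovProduct (f 0) (f (2 ^ k)) p := by
  induction k generalizing f with
  | zero => simpa using hf 0 (by simp)
  | succ k ih =>
    have h₁ := ih f fun i hi => hf i (by rw [pow_succ]; omega)
    have h₂ := ih (fun i => f (2 ^ k + i)) fun i hi => by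
      simpa [add_assoc] using hf (2 ^ k + i) (by rw [pow_succ]; omega)
    have h₃ := h.le_gromovProduct h₁ (by simpa using h₂)
    have e : 2 ^ k + 2 ^ k = 2 ^ (k + 1) := by ring
    rw [e] at h₃
    push_cast
    linarith

/-! ### Quasi-geodesics -/

lemma IsQuasiGeodesic.const_nonneg {lam c l : ℝ} {γ : ℝ → X} (h : IsQuasiGeodesic lam c l γ) :
    0 ≤ c := by
  have := (h.2 0 ⟨le_rfl, h.1⟩ 0 ⟨le_rfl, h.1⟩).2
  simpa using this

lemma IsQuasiGeodesic.abs_sub_le {lam c l : ℝ} {γ : ℝ → X} (h : IsQuasiGeodesic lam c l γ)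
    (hlam : 0 < lam) {s t : ℝ} (hs : s ∈ Set.Icc 0 l) (ht : t ∈ Set.Icc 0 l) :
    |s - t| ≤ lam * (dist (γ s) (γ t) + c) := by
  have := (h.2 s hs t ht).1
  rw [one_div, sub_le_iff_le_add, inv_mul_le_iff₀ hlam] at this
  exact this

lemma IsQuasiGeodesic.isCompact_image {lam l : ℝ} {γ : ℝ → X} (h : IsQuasiGeodesic lam 0 l γ)
    (hlam : 0 ≤ lam) : IsCompact (γ '' Set.Icc 0 l) := by
  refine isCompact_Icc.image_of_continuousOn
    (LipschitzOnWith.continuousOn (K := lam.toNNReal) (LipschitzOnWith.of_dist_le_mul ?_))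
  intro s hs t ht
  simpa [Real.dist_eq, Real.coe_toNNReal _ hlam] using (h.2 s hs t ht).2

/-- Equal subdivision of the parameter interval between `a` and `b`: if a quasi-geodesic stays at
distance at least `D` from `p` and `2 ^ k` pieces make the steps at most `2 m` long, then the
Gromov product of `γ a` and `γ b` at `p` is at least `D - m - k δ`. -/
lemma IsQuasiGeodesic.le_gromovProduct {δ lam c l m D a b : ℝ} {γ : ℝ → X} {p : X}
    (h : IsQuasiGeodesic lam c l γ) (hδ : IsHyperbolic X δ) (hcm : c ≤ m) (k : ℕ)
    (hD : ∀ s ∈ Set.Icc 0 l, D ≤ dist (γ s) p)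
    (ha : a ∈ Set.Icc 0 l) (hb : b ∈ Set.Icc 0 l) (hk : lam * |a - b| ≤ 2 ^ k * m) :
    D - m - k * δ ≤ gromovProduct (γ a) (γ b) p := by
  have h2 : (0 : ℝ) < 2 ^ k := by positivity
  set g : ℕ → ℝ := fun i => a + (i / 2 ^ k : ℝ) * (b - a) with hg
  have hmem : ∀ i : ℕ, i ≤ 2 ^ k → g i ∈ Set.Icc 0 l := by
    intro i hi
    have hi' : (i : ℝ) / 2 ^ k ≤ 1 := by
      rw [div_le_one h2]; exact_mod_cast hi
    have := (convex_Icc (0 : ℝ) l).add_smul_sub_mem ha hb ⟨by positivity, hi'⟩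
    simpa [hg, smul_eq_mul] using this
  have key := hδ.gromovProduct_chain (p := p) (r := D - m) k (fun i => γ (g i)) (by
    intro i hi
    have h₁ := hD _ (hmem i hi.le)
    have h₂ := hD _ (hmem (i + 1) hi)
    have h₃ := (h.2 _ (hmem i hi.le) _ (hmem (i + 1) hi)).2
    have h₄ : |g i - g (i + 1)| = |a - b| / 2 ^ k := by
      have : g i - g (i + 1) = (a - b) / 2 ^ k := by
        simp only [hg]; push_cast; ring
      rw [this, abs_div, abs_of_pos h2]
    have h₅ : lam * |g i - g (i + 1)| ≤ m := by
      rw [h₄, ← mul_div_assoc, div_le_iff₀ h2]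
      linarith
    simp only [gromovProduct]
    linarith)
  have e₀ : g 0 = a := by simp [hg]
  have e₁ : g (2 ^ k) = b := by simp [hg]
  simpa only [e₀, e₁] using key

/-! ### The logarithmic estimate -/

/-- A number of halvings that makes the steps short enough. -/
lemma exists_nat_le_two_pow {y : ℝ} (hy : 1 ≤ y) :
    ∃ k : ℕ, y ≤ 2 ^ k ∧ (k : ℝ) ≤ 2 * Real.log y + 1 := by
  have hlog := Real.log_nonneg hy
  refine ⟨⌈2 * Real.log y⌉₊, ?_, (Nat.ceil_lt_add_one (by positivity)).le⟩
  rw [← Real.log_le_log_iff (by positivity) (by positivity), Real.log_pow]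
  -- `2 * log 2 ≥ 1`
  nlinarith [Nat.le_ceil (2 * Real.log y), Real.log_two_gt_d9]

/-- If `u ≤ 3 + k` whenever `2 ^ k ≥ λ² (6 u + 3)`, then `u` is of order at most `log λ`. -/
lemma le_of_forall_two_pow {u lam : ℝ} (hu : 0 ≤ u) (hlam : 1 ≤ lam)
    (h : ∀ k : ℕ, lam ^ 2 * (6 * u + 3) ≤ 2 ^ k → u ≤ 3 + k) :
    u ≤ 100 + 8 * Real.log lam := by
  obtain ⟨k, hk, hk'⟩ := exists_nat_le_two_pow (y := lam ^ 2 * (6 * u + 3)) (by nlinarith)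
  have h₁ := h k hk
  rw [Real.log_mul (by positivity) (by positivity), Real.log_pow] at hk'
  -- `log` is bounded by its tangent line; the factor 24 makes the slope small enough to absorb `u`.
  have h₂ : Real.log (6 * u + 3) ≤ (6 * u + 3) / 24 - 1 + 23 := by
    have e : 6 * u + 3 = (6 * u + 3) / 24 * 24 := by ring
    conv_lhs => rw [e]
    rw [Real.log_mul (by positivity) (by norm_num)]
    have := Real.log_le_sub_one_of_pos (x := (6 * u + 3) / 24) (by positivity)
    have := Real.log_le_sub_one_of_pos (x := (24 : ℝ)) (by norm_num)
    linarith
  push_cast at hk'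
  linarith

/-! ### The farthest point of the geodesic -/

/-- Going from `σ τ` towards an endpoint `σ e`, which lies on `S`, there is a point `σ e'` between
them at distance at most `2 D` from `σ τ`, and near it a point `q` of `S`, such that the Gromov
product of `σ e'` and `q` at `σ τ` is almost `D`: either `σ e'` is at distance exactly `2 D`, or it
is the endpoint and `q` equals it. -/
lemma exists_near_point {S : Set X} {σ : ℝ → X} {L τ e D m : ℝ} (hm : 0 < m)
    (hσ : ∀ s ∈ Set.Icc 0 L, ∀ t ∈ Set.Icc 0 L, dist (σ s) (σ t) = |s - t|)
    (hmax : ∀ s ∈ Set.Icc 0 L, Metric.infDist (σ s) S ≤ D)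
    (hfar : ∀ q ∈ S, D ≤ dist q (σ τ)) (hD : 0 ≤ D)
    (hτ : τ ∈ Set.Icc 0 L) (he : e ∈ Set.Icc 0 L) (heS : σ e ∈ S) :
    ∃ e' ∈ Set.uIcc τ e, |e' - τ| ≤ 2 * D ∧
      ∃ q ∈ S, dist (σ e') q ≤ D + m ∧ D - m ≤ gromovProduct (σ e') q (σ τ) := by
  by_cases hclose : |e - τ| ≤ 2 * D
  · refine ⟨e, Set.right_mem_uIcc, hclose, σ e, heS, by simp; positivity, ?_⟩
    have := hfar _ heS
    simp only [gromovProduct, dist_self]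
    linarith
  · rw [not_le] at hclose
    obtain ⟨e', he', hdist⟩ : ∃ e' ∈ Set.uIcc τ e, |e' - τ| = 2 * D := by
      rcases le_total τ e with h | h
      · rw [abs_of_nonneg (by linarith)] at hclose
        exact ⟨τ + 2 * D, by rw [Set.uIcc_of_le h]; constructor <;> linarith,
          by rw [add_sub_cancel_left, abs_of_nonneg (by positivity)]⟩
      · rw [abs_of_nonpos (by linarith)] at hclose
        exact ⟨τ - 2 * D, by rw [Set.uIcc_of_ge h]; constructor <;> linarith,
          by rw [sub_sub_cancel_left, abs_neg, abs_of_nonneg (by positivity)]⟩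
    have hmem : e' ∈ Set.Icc 0 L := Set.uIcc_subset_Icc hτ he he'
    obtain ⟨q, hq, hlt⟩ := (Metric.infDist_lt_iff (r := D + m) ⟨_, heS⟩).1
      (lt_of_le_of_lt (hmax e' hmem) (by linarith))
    refine ⟨e', he', hdist.le, q, hq, hlt.le, ?_⟩
    have h₁ := hfar q hq
    have h₂ := hσ e' hmem τ hτ
    simp only [gromovProduct]
    linarith

/-- Bound on the distance from the image of `γ` to the farthest point `σ τ` of a geodesic with
endpoints on it. -/
lemma infDist_le_of_isMaximal {δ lam c l m L τ : ℝ} {γ σ : ℝ → X} {x y : X}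
    (hδ : IsHyperbolic X δ) (hlam : 1 ≤ lam) (hγ : IsQuasiGeodesic lam c l γ)
    (hm : 0 < m) (hcm : c ≤ m) (hδm : δ ≤ m)
    (hx : x ∈ γ '' Set.Icc 0 l) (hy : y ∈ γ '' Set.Icc 0 l) (hσ : IsGeodesicSegment L σ x y)
    (hτ : τ ∈ Set.Icc 0 L)
    (hmax : ∀ s ∈ Set.Icc 0 L, Metric.infDist (σ s) (γ '' Set.Icc 0 l) ≤
      Metric.infDist (σ τ) (γ '' Set.Icc 0 l)) :
    Metric.infDist (σ τ) (γ '' Set.Icc 0 l) ≤ (100 + 8 * Real.log lam) * m := by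
  obtain ⟨hL, hiso, h0, h1⟩ := hσ
  set S := γ '' Set.Icc 0 l with hS
  set D := Metric.infDist (σ τ) S with hDdef
  have hD : 0 ≤ D := Metric.infDist_nonneg
  have hfar : ∀ q ∈ S, D ≤ dist q (σ τ) := fun q hq => by
    rw [dist_comm]; exact Metric.infDist_le_dist_of_mem hq
  have hlam0 : 0 < lam := by linarith
  obtain ⟨e₁, he₁, hd₁, _, ⟨a, ha, rfl⟩, hq₁, hg₁⟩ := exists_near_point hm hiso hmax hfar hD hτ
    (e := 0) ⟨le_rfl, hL⟩ (h0 ▸ hx)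
  obtain ⟨e₂, he₂, hd₂, _, ⟨b, hb, rfl⟩, hq₂, hg₂⟩ := exists_near_point hm hiso hmax hfar hD hτ
    (e := L) ⟨hL, le_rfl⟩ (h1 ▸ hy)
  rw [Set.uIcc_of_ge hτ.1] at he₁
  rw [Set.uIcc_of_le hτ.2] at he₂
  have m₁ : e₁ ∈ Set.Icc 0 L := ⟨he₁.1, he₁.2.trans hτ.2⟩
  have m₂ : e₂ ∈ Set.Icc 0 L := ⟨hτ.1.trans he₂.1, he₂.2⟩
  have d₁₂ := hiso e₁ m₁ e₂ m₂
  have d₁ := hiso e₁ m₁ τ hτ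
  have d₂ := hiso e₂ m₂ τ hτ
  rw [abs_of_nonpos (by linarith [he₁.2])] at d₁ hd₁
  rw [abs_of_nonneg (by linarith [he₂.1])] at d₂ hd₂
  rw [abs_of_nonpos (by linarith [he₁.2, he₂.1])] at d₁₂
  have hdist : dist (γ a) (γ b) ≤ 6 * D + 2 * m := by
    have := dist_triangle4 (γ a) (σ e₁) (σ e₂) (γ b)
    rw [dist_comm (γ a) (σ e₁)] at this
    linarith
  have hab : |a - b| ≤ lam * (6 * D + 3 * m) :=
    (hγ.abs_sub_le hlam0 ha hb).trans (mul_le_mul_of_nonneg_left (by linarith) hlam0.le)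
  have hδ0 : 0 ≤ δ := by
    have : Nonempty X := ⟨x⟩
    exact hδ.nonneg
  have huse : D / m ≤ 100 + 8 * Real.log lam := by
    refine le_of_forall_two_pow (by positivity) hlam fun k hk => ?_
    have hk' : lam * |a - b| ≤ 2 ^ k * m := by
      calc lam * |a - b| ≤ lam * (lam * (6 * D + 3 * m)) := by gcongr
        _ = lam ^ 2 * (6 * (D / m) + 3) * m := by field_simp
        _ ≤ 2 ^ k * m := by gcongr
    have hab' := hγ.le_gromovProduct hδ hcm k (fun s hs => hfar _ ⟨s, hs, rfl⟩) ha hb hk'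
    have hkδ : 0 ≤ k * δ := by positivity
    have hleft := hδ.le_gromovProduct (r := D - m - k * δ) (by linarith) hab'
    have hg₂' : D - m ≤ gromovProduct (γ b) (σ e₂) (σ τ) := by
      simp only [gromovProduct] at hg₂ ⊢
      rw [dist_comm (γ b) (σ e₂)]
      linarith
    have hend := hδ.le_gromovProduct (r := D - m - k * δ - δ) hleft (by linarith)
    -- `σ τ` lies on the geodesic between `σ e₁` and `σ e₂`.
    have hzero : gromovProduct (σ e₁) (σ e₂) (σ τ) = 0 := by
      rw [gromovProduct, d₁, d₂, d₁₂]; ring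
    rw [hzero] at hend
    have hkm : (k : ℝ) * δ ≤ k * m := by gcongr
    rw [div_le_iff₀ hm]
    linarith
  rwa [div_le_iff₀ hm] at huse

/-- Every point of a geodesic with endpoints on `γ`, not only the farthest one, is close to `γ`;
the farthest point exists by compactness of the geodesic. -/
lemma IsGeodesicSegment.infDist_le {δ lam c l m L : ℝ} {γ σ : ℝ → X} {x y : X}
    (hσ : IsGeodesicSegment L σ x y)
    (hδ : IsHyperbolic X δ) (hlam : 1 ≤ lam) (hγ : IsQuasiGeodesic lam c l γ)
    (hm : 0 < m) (hcm : c ≤ m) (hδm : δ ≤ m)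
    (hx : x ∈ γ '' Set.Icc 0 l) (hy : y ∈ γ '' Set.Icc 0 l) {s : ℝ} (hs : s ∈ Set.Icc 0 L) :
    Metric.infDist (σ s) (γ '' Set.Icc 0 l) ≤ (100 + 8 * Real.log lam) * m := by
  have hcont : ContinuousOn σ (Set.Icc 0 L) := by
    refine LipschitzOnWith.continuousOn (K := 1) (LipschitzOnWith.of_dist_le_mul ?_)
    intro s hs t ht
    simp [hσ.2.1 s hs t ht, Real.dist_eq]
  obtain ⟨τ, hτ, hmax⟩ := isCompact_Icc.exists_isMaxOn ⟨s, hs⟩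
    ((Metric.continuous_infDist_pt (γ '' Set.Icc 0 l)).comp_continuousOn hcont)
  exact (hmax hs).trans
    (infDist_le_of_isMaximal hδ hlam hγ hm hcm hδm hx hy hσ hτ fun _ ht => hmax ht)

/-! ### Quasiconvexity -/

theorem IsQuasiGeodesic.isQuasiconvex {δ lam₀ lam c l : ℝ} {γ : ℝ → X}
    (hγ : IsQuasiGeodesic lam c l γ) (hδ : IsHyperbolic X δ) (hlam₀ : 1 < lam₀)
    (hlam : lam₀ ≤ lam) :
    IsQuasiconvex ((101 / Real.log lam₀ + 8) * (c + δ) * Real.log lam) (γ '' Set.Icc 0 l) := by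
  rintro x hx y hy L σ hσ _ ⟨s, hs, rfl⟩
  have hc := hγ.const_nonneg
  have hδ0 : 0 ≤ δ := by
    have : Nonempty X := ⟨x⟩
    exact hδ.nonneg
  have hlam1 : 1 ≤ lam := by linarith
  have hbound := fun m hm hcm hδm =>
    hσ.infDist_le (m := m) hδ hlam1 hγ hm hcm hδm hx hy hs
  rcases (add_nonneg hc hδ0).eq_or_lt with h | h
  · obtain rfl : c = 0 := by linarith
    obtain rfl : δ = 0 := by linarith
    have hlog : 0 < 100 + 8 * Real.log lam := by
      have := Real.log_nonneg hlam1
      positivity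
    have hzero : Metric.infDist (σ s) (γ '' Set.Icc 0 l) = 0 := by
      refine le_antisymm (le_of_forall_pos_le_add fun ε hε => ?_) Metric.infDist_nonneg
      have hpos := div_pos hε hlog
      have := hbound _ hpos hpos.le hpos.le
      rwa [mul_div_cancel₀ _ hlog.ne', ← zero_add ε] at this
    refine ⟨σ s, ?_, by simp⟩
    exact ((hγ.isCompact_image (by linarith)).isClosed.mem_iff_infDist_zero ⟨x, hx⟩).2 hzero
  · -- One more summand `c + δ` pays for the infimum distance not being attained.
    obtain ⟨q, hq, hlt⟩ := (Metric.infDist_lt_iff ⟨x, hx⟩).1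
      (lt_add_of_le_of_pos (hbound (c + δ) h (by linarith) (by linarith)) h)
    refine ⟨q, hq, hlt.le.trans ?_⟩
    have hl₀ : 0 < Real.log lam₀ := Real.log_pos hlam₀
    have hl : Real.log lam₀ ≤ Real.log lam := Real.log_le_log (by linarith) hlam
    have h101 : 101 ≤ 101 / Real.log lam₀ * Real.log lam := by
      rw [div_mul_eq_mul_div, le_div_iff₀ hl₀]
      linarith
    calc (100 + 8 * Real.log lam) * (c + δ) + (c + δ)
        = (101 + 8 * Real.log lam) * (c + δ) := by ring
      _ ≤ (101 / Real.log lam₀ * Real.log lam + 8 * Real.log lam) * (c + δ) := by gcongr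
      _ = (101 / Real.log lam₀ + 8) * (c + δ) * Real.log lam := by ring

end AntiMorse

theorem theorem2 (lam₀ : ℝ) (hlam₀ : 1 < lam₀) :
    ∃ A₃ : ℝ, 0 < A₃ ∧
      ∀ (X : Type*) [MetricSpace X] (δ lam c l : ℝ) (γ : ℝ → X),
        AntiMorse.IsHyperbolic X δ →
        lam₀ ≤ lam → 4 * δ ≤ Real.log lam →
        AntiMorse.IsQuasiGeodesic lam c l γ →
          (∀ (L : ℝ) (σ : ℝ → X), AntiMorse.IsGeodesicSegment L σ (γ 0) (γ l) →
            AntiMorse.InNeighborhood (A₃ * (c + δ) * Real.log lam)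
              (σ '' Set.Icc 0 L) (γ '' Set.Icc 0 l)) ∧
          AntiMorse.IsQuasiconvex (A₃ * (c + δ) * Real.log lam) (γ '' Set.Icc 0 l) := by
  have hl₀ : 0 < Real.log lam₀ := Real.log_pos hlam₀
  refine ⟨101 / Real.log lam₀ + 8, by positivity, ?_⟩
  intro X _ δ lam c l γ hδ hlam _ hγ
  have hq := hγ.isQuasiconvex hδ hlam₀ hlam
  exact ⟨hq _ ⟨0, ⟨le_rfl, hγ.1⟩, rfl⟩ _ ⟨l, ⟨hγ.1, le_rfl⟩, rfl⟩, hq⟩
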